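/- **Theorem (Tightness analysis of Perturbed Smoothed GDA).** *Setting.* Consider $\min_{x\in\mathcal X}\max_{y\in\mathcal Y} f(x,y)$. The function $f$ is $\ell$-smooth if it is $C^1$ and $\|\nabla_x f(x,y)-\nabla_x f(x',y')\|$ and $\|\nabla_y f(x,y)-\nabla_y f(x',y')\|$ are both at most $\ell(\|x-x'\|+\|y-y'\|)$ on $\mathcal X\times\mathcal Y$. For $r_x,r_y>0$ put $$\tilde f(x,y)=f(x,y)-\tfrac{r_y}{2}\|y\|^2,\qquad \tilde F(x,y,z)=f(x,y)+\tfrac{r_x}{2}\|x-z\|^2-\tfrac{r_y}{2}\|y\|^2 .$$ Perturbed Smoothed GDA with parameters $r_x,r_y,c,\alpha,\beta$, started at $(x_0,y_0,z_0)$ with $x_0\in\mathcal X$, $y_0\in\mathcal Y$, is $$x_{t+1}=\mathrm{proj}_{\mathcal X}\big(x_t-c\nabla_x\tilde F(x_t,y_t,z_t)\big),\quad y_{t+1}=\mathrm{proj}_{\mathcal Y}\big(y_t+\alpha\nabla_y\tilde F(x_{t+1},y_t,z_t)\big),\quad z_{t+1}=z_t+\beta(x_{t+1}-z_t).$$ Its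 initial gap is $\Delta_{\Psi_2}=\Psi_2(x_0,y_0,z_0)-\min_{x\in\mathcal X}\max_{y\in\mathcal Y}\tilde f(x,y)$, where $$\Psi_2(x,y,z)=\tilde F(x,y,z)-2\min_{u\in\mathcal X}\tilde F(u,y,z)+2\min_{u\in\mathcal X}\max_{v\in\mathcal Y}\tilde F(u,v,z).$$ *Stationarity.* Let $\iota_{\mathcal S}$ be the indicator function of $\mathcal S$. A pair $(x,y)\in\mathcal X\times\mathcal Y$ is an $\epsilon$-GS if $\mathrm{dist}(0,\nabla_x f(x,y)+\partial\iota_{\mathcal X}(x))\le\epsilon$ and $\mathrm{dist}(0,-\nabla_y f(x,y)+\partial\iota_{\mathcal Y}(y))\le\epsilon$. A point $x\in\mathcal X$ is an $\epsilon$-OS if $\|\mathrm{prox}_{\frac1{2\ell}\Phi}(x)-x\|\le\frac{\epsilon}{2\ell}$, where $\Phi=\max_{y\in\mathcal Y}f(\cdot,y)+\iota_{\mathcal X}$. *Step-size conditions with $\Theta$-constant $K\ge1$.* Write $a=\Theta_K(b)$ for $b/K\le a\le Kb$. The conditions are: $r_y>0$; $r_x=\Theta_K(\ell)$ and $r_x>3\ell$;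 $c=\Theta_K(1/\ell)$ and $0<c<\frac1{r_x+\ell}$; $\alpha=\Theta_K(1/\ell)$ and $0<\alpha\le\min\big\{\frac1{11\ell},\frac{c^2(r_x-\ell)^2}{4\ell(1+c(r_x-\ell))^2}\big\}$; $\beta=\Theta_K(r_y/\ell)$ and $0<\beta\le\min\big\{\frac1{36},\frac{(r_x-\ell)^2}{384\,r_x(r_x+\ell)^2},\frac1{384\,r_x\alpha\omega^2}\big\}$, where $\omega=\frac1{\sqrt{2r_y}}\cdot\frac{(r_x-\ell)+\alpha\ell(3r_x-2\ell)}{\alpha(r_x-\ell)^{3/2}}$. *Claim.* For every $K\ge1$ there is a constant $\kappa>0$, depending only on $K$, such that the following hold for all $\ell>0$, $D_{\mathcal Y}>0$, $\epsilon>0$ and all parameters satisfying the step-size conditions. 1. (Game stationarity) If $r_y=\Theta_K(\epsilon/D_{\mathcal Y})$, then there are an $\ell$-smooth function $f$ on $\mathcal X\times\mathcal Y=\mathbb R\times[0,D_{\mathcal Y}]$, concave in $y$, for which $\min_x\max_y\tilde f$ is attained, and an initialization $(x_0,y_0,z_0)$ with $\Delta_{\Psi_2}\ge\kappa\,\epsilon^2/\ell$,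 such that some iterate $(x_T,y_T)$ of Perturbed Smoothed GDA is an $\epsilon$-GS, and whenever $(x_T,y_T)$ is an $\epsilon$-GS, then $$T\ \ge\ \kappa\,\frac{\ell^2D_{\mathcal Y}\Delta_{\Psi_2}}{\epsilon^3}.$$ 2. (Optimization stationarity) If $r_y=\Theta_K(\epsilon^2/(\ell D_{\mathcal Y}^2))$, then there are an $\ell$-smooth function $f$ on $\mathbb R\times[0,D_{\mathcal Y}]$, concave in $y$, for which $\min_x\max_y\tilde f$ is attained, and an initialization $(x_0,y_0,z_0)$ with $\Delta_{\Psi_2}\ge\kappa\,\epsilon^2/\ell$, such that some iterate $x_T$ of Perturbed Smoothed GDA is an $\epsilon$-OS, and whenever $x_T$ is an $\epsilon$-OS, then $$T\ \ge\ \kappa\,\frac{\ell^3D_{\mathcal Y}^2\Delta_{\Psi_2}}{\epsilon^4}.$$ -/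

import Mathlib

/-!
At `y = D` the coupling in `(l / 2) x² + l x (y - D) + a y` vanishes, and the linear term with
slope `a = r_y D` outweighs the dual perturbation, so the dual iterate never leaves `D` while
`x ≥ 0`. The primal iterates are then those of smoothed gradient descent on `(l / 2) x²`. The
proximal point of a centre `z` is `ρ z` with `ρ = r_x / (l + r_x)`, and from a start `x = z = R`
the iterates stay in the cone `ρ z ≤ x ≤ z`, so the centre loses at most the fraction `β` per step.

Stationarity amounts to `l x ≤ ε` for games and to `l x ≤ (3 / 2) ε` for optimization. As `ρ` is
bounded below in terms of `K`, from a height `R ≍ ε / l` this takes at least about `1 / β ≍ l / r_y`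
steps, but finitely many. The initial gap is `l R² / 2 ≍ ε² / l`, because `(ρ z, D)` is a saddle
point of the surrogate.
-/

noncomputable section

/-- `a = Θ(b)` with explicit constant `K`. -/
def IsTheta (K a b : ℝ) : Prop := b / K ≤ a ∧ a ≤ K * b

section General

variable {E F : Type*}
  [NormedAddCommGroup E] [InnerProductSpace ℝ E] [CompleteSpace E]
  [NormedAddCommGroup F] [InnerProductSpace ℝ F] [CompleteSpace F]

/-- The partial gradient `∇ₓ f(x, y)`. -/
def gradX (f : E → F → ℝ) (x : E) (y : F) : E := gradient (fun u => f u y) x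

/-- The partial gradient `∇_y f(x, y)`. -/
def gradY (f : E → F → ℝ) (x : E) (y : F) : F := gradient (fun v => f x v) y

/-- `f` is continuously differentiable and `ℓ`-smooth on `X × Y`. -/
structure IsLSmooth (l : ℝ) (f : E → F → ℝ) (X : Set E) (Y : Set F) : Prop where
  contDiff : ContDiff ℝ 1 (fun p : E × F => f p.1 p.2)
  lipX : ∀ x ∈ X, ∀ x' ∈ X, ∀ y ∈ Y, ∀ y' ∈ Y,
    ‖gradX f x y - gradX f x' y'‖ ≤ l * (‖x - x'‖ + ‖y - y'‖)
  lipY : ∀ x ∈ X, ∀ x' ∈ X, ∀ y ∈ Y, ∀ y' ∈ Y,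
    ‖gradY f x y - gradY f x' y'‖ ≤ l * (‖x - x'‖ + ‖y - y'‖)

/-- `p` is the projection of `u` onto the (closed convex) set `S`. -/
def IsProj (S : Set E) (u p : E) : Prop := p ∈ S ∧ IsMinOn (fun v => ‖v - u‖) S p

/-- `p = prox_{r Φ}(u)`, where `Φ` is understood to be `+∞` outside `X`. -/
def IsProx (r : ℝ) (Φ : E → ℝ) (X : Set E) (u p : E) : Prop :=
  p ∈ X ∧ IsMinOn (fun v => Φ v + 1 / (2 * r) * ‖v - u‖ ^ 2) X p

/-- The subdifferential at `x` of the indicator function of a convex set `S`. -/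
def normalCone (S : Set E) (x : E) : Set E := {v | ∀ u ∈ S, inner ℝ v (u - x) ≤ 0}

/-- `max_{y ∈ Y} f(x, y)`. -/
def maxOver (Y : Set F) (f : E → F → ℝ) (x : E) : ℝ := sSup (f x '' Y)

/-- `min_{x ∈ X} g(x)`. -/
def minOver (X : Set E) (g : E → ℝ) : ℝ := sInf (g '' X)

/-- `x` is an `ε`-optimization-stationary point of `min_{x ∈ X} max_{y ∈ Y} f(x, y)`. -/
def IsOS (l ε : ℝ) (f : E → F → ℝ) (X : Set E) (Y : Set F) (x : E) : Prop :=
  x ∈ X ∧ ∃ p, IsProx (1 / (2 * l)) (maxOver Y f) X x p ∧ ‖p - x‖ ≤ ε / (2 * l)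

/-- `(x, y)` is an `ε`-game-stationary point of `min_{x ∈ X} max_{y ∈ Y} f(x, y)`. -/
def IsGS (ε : ℝ) (f : E → F → ℝ) (X : Set E) (Y : Set F) (x : E) (y : F) : Prop :=
  x ∈ X ∧ y ∈ Y ∧
  Metric.infDist 0 ((fun v => gradX f x y + v) '' normalCone X x) ≤ ε ∧
  Metric.infDist 0 ((fun v => -gradY f x y + v) '' normalCone Y y) ≤ ε

/-- The dually perturbed objective `f(x, y) - (r_y / 2) ‖y‖²`. -/
def perturbed (f : E → F → ℝ) (ry : ℝ) (x : E) (y : F) : ℝ :=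
  f x y - ry / 2 * ‖y‖ ^ 2

/-- The surrogate `f(x, y) + (r_x / 2) ‖x - z‖² - (r_y / 2) ‖y‖²`. -/
def surrogate (f : E → F → ℝ) (rx ry : ℝ) (z : E) (x : E) (y : F) : ℝ :=
  f x y + rx / 2 * ‖x - z‖ ^ 2 - ry / 2 * ‖y‖ ^ 2

/-- The potential function `Ψ₂`. -/
def potential (f : E → F → ℝ) (X : Set E) (Y : Set F) (rx ry : ℝ)
    (x : E) (y : F) (z : E) : ℝ :=
  surrogate f rx ry z x y
    - 2 * minOver X (fun u => surrogate f rx ry z u y)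
    + 2 * minOver X (maxOver Y (surrogate f rx ry z))

/-- The initial gap `Δ_{Ψ₂}`, as a function of the initial point. -/
def initialGap (f : E → F → ℝ) (X : Set E) (Y : Set F) (rx ry : ℝ)
    (x : E) (y : F) (z : E) : ℝ :=
  potential f X Y rx ry x y z - minOver X (maxOver Y (perturbed f ry))

end General

/-- The parameters of Perturbed Smoothed GDA. -/
structure PSGDAParams where
  rx : ℝ
  ry : ℝ
  c : ℝ
  α : ℝ
  β : ℝ

/-- The constant `ω` of the step-size condition. -/
def PSGDAParams.omega (p : PSGDAParams) (l : ℝ) : ℝ :=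
  1 / Real.sqrt (2 * p.ry) *
    (((p.rx - l) + p.α * l * (3 * p.rx - 2 * l)) / (p.α * (p.rx - l) ^ (3 / 2 : ℝ)))

/-- The step-size conditions of Perturbed Smoothed GDA; `K` is the constant in all the `Θ`'s. -/
structure PSGDAParams.StepSizeCondition (p : PSGDAParams) (K l : ℝ) : Prop where
  rx_theta : IsTheta K p.rx l
  rx_gt : 3 * l < p.rx
  ry_pos : 0 < p.ry
  α_theta : IsTheta K p.α (1 / l)
  α_pos : 0 < p.α
  α_le : p.α ≤ min (1 / (11 * l))
    (p.c ^ 2 * (p.rx - l) ^ 2 / (4 * l * (1 + p.c * (p.rx - l)) ^ 2))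
  c_theta : IsTheta K p.c (1 / l)
  c_pos : 0 < p.c
  c_lt : p.c < 1 / (p.rx + l)
  β_theta : IsTheta K p.β (p.ry / l)
  β_pos : 0 < p.β
  β_le : p.β ≤ min (1 / 36) ((p.rx - l) ^ 2 / (384 * p.rx * (p.rx + l) ^ 2))
  β_le_omega : p.β ≤ 1 / (384 * p.rx * p.α * p.omega l ^ 2)

/-- `(x t, y t, z t)` are the iterates of Perturbed Smoothed GDA on
`min_{x ∈ X} max_{y ∈ Y} f(x, y)`, started at `(x 0, y 0, z 0)`. -/
structure IsPSGDARun {E F : Type*}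
    [NormedAddCommGroup E] [InnerProductSpace ℝ E] [CompleteSpace E]
    [NormedAddCommGroup F] [InnerProductSpace ℝ F] [CompleteSpace F]
    (f : E → F → ℝ) (X : Set E) (Y : Set F) (p : PSGDAParams)
    (x : ℕ → E) (y : ℕ → F) (z : ℕ → E) : Prop where
  init_x : x 0 ∈ X
  init_y : y 0 ∈ Y
  step_x : ∀ t, IsProj X
    (x t - p.c • gradX (surrogate f p.rx p.ry (z t)) (x t) (y t)) (x (t + 1))
  step_y : ∀ t, IsProj Y
    (y t + p.α • gradY (surrogate f p.rx p.ry (z t)) (x (t + 1)) (y t)) (y (t + 1))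
  step_z : ∀ t, z (t + 1) = z t + p.β • (x (t + 1) - z t)

/-- A one-dimensional problem `min_{x ∈ ℝ} max_{y ∈ [0, D]} f(x, y)` with `f` `ℓ`-smooth, concave
in `y`, and whose perturbed value function attains its minimum. -/
structure IsInstance (l D ry : ℝ) (f : ℝ → ℝ → ℝ) : Prop where
  smooth : IsLSmooth l f Set.univ (Set.Icc 0 D)
  concave : ∀ x, ConcaveOn ℝ (Set.Icc 0 D) (f x)
  attained : ∃ x₀, IsMinOn (maxOver (Set.Icc 0 D) (perturbed f ry)) Set.univ x₀

end

section Saddle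

variable {E F : Type*}

lemma minOver_eq_of_isMinOn {X : Set E} {g : E → ℝ} {u : E} (hu : u ∈ X) (h : IsMinOn g X u) :
    minOver X g = g u :=
  IsLeast.csInf_eq ⟨Set.mem_image_of_mem g hu, Set.forall_mem_image.2 h⟩

lemma isMinOn_iff_eq_of_forall_lt {X : Set E} {g : E → ℝ} {u v : E} (hu : u ∈ X) (hv : v ∈ X)
    (h : ∀ w ∈ X, w ≠ u → g u < g w) : IsMinOn g X v ↔ v = u := by
  constructor
  · intro hmin
    by_contra hne
    exact (h v hv hne).not_ge (hmin hu)
  · rintro rfl w hw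
    obtain rfl | hne := eq_or_ne w v
    · exact le_refl (g w)
    · exact (h w hw hne).le

lemma maxOver_eq_of_isMaxOn {Y : Set F} {h : E → F → ℝ} {u : E} {w : F} (hw : w ∈ Y)
    (hmax : IsMaxOn (h u) Y w) : maxOver Y h u = h u w :=
  IsGreatest.csSup_eq ⟨Set.mem_image_of_mem (h u) hw, Set.forall_mem_image.2 hmax⟩

lemma le_maxOver {Y : Set F} {h : E → F → ℝ} {u : E} {w : F} (hb : BddAbove (h u '' Y))
    (hw : w ∈ Y) : h u w ≤ maxOver Y h u :=
  le_csSup hb (Set.mem_image_of_mem (h u) hw)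

variable {X : Set E} {Y : Set F} {h : E → F → ℝ} {u : E} {w : F}

lemma maxOver_eq_of_isSaddlePointOn (hu : u ∈ X) (hw : w ∈ Y) (hs : IsSaddlePointOn X Y h u w) :
    maxOver Y h u = h u w :=
  maxOver_eq_of_isMaxOn hw (hs u hu)

lemma isMinOn_maxOver_of_isSaddlePointOn (hb : ∀ x ∈ X, BddAbove (h x '' Y)) (hu : u ∈ X)
    (hw : w ∈ Y) (hs : IsSaddlePointOn X Y h u w) : IsMinOn (maxOver Y h) X u := by
  intro x hx
  calc maxOver Y h u = h u w := maxOver_eq_of_isSaddlePointOn hu hw hs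
    _ ≤ h x w := hs x hx w hw
    _ ≤ maxOver Y h x := le_maxOver (hb x hx) hw

lemma minOver_eq_of_isSaddlePointOn (hu : u ∈ X) (hw : w ∈ Y) (hs : IsSaddlePointOn X Y h u w) :
    minOver X (fun x => h x w) = h u w :=
  minOver_eq_of_isMinOn hu fun x hx => hs x hx w hw

lemma minOver_maxOver_eq_of_isSaddlePointOn (hb : ∀ x ∈ X, BddAbove (h x '' Y)) (hu : u ∈ X)
    (hw : w ∈ Y) (hs : IsSaddlePointOn X Y h u w) : minOver X (maxOver Y h) = h u w :=
  (minOver_eq_of_isMinOn hu (isMinOn_maxOver_of_isSaddlePointOn hb hu hw hs)).trans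
    (maxOver_eq_of_isSaddlePointOn hu hw hs)

end Saddle

section InnerProductSpace

variable {E : Type*} [NormedAddCommGroup E] [InnerProductSpace ℝ E]

lemma normalCone_univ (x : E) : normalCone Set.univ x = {0} := by
  refine Set.eq_singleton_iff_unique_mem.2 ⟨fun u _ => (inner_zero_left _).le, fun v hv => ?_⟩
  have hvv : inner ℝ v v ≤ 0 := by simpa using hv (x + v) (Set.mem_univ _)
  exact real_inner_self_nonpos.1 hvv

lemma infDist_zero_add_normalCone_univ (g x : E) :
    Metric.infDist 0 ((fun v => g + v) '' normalCone Set.univ x) = ‖g‖ := by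
  rw [normalCone_univ, Set.image_singleton, Metric.infDist_singleton, add_zero, dist_zero_left]

end InnerProductSpace

section Surrogate

lemma perturbed_zero {E F : Type*} [NormedAddCommGroup F] (f : E → F → ℝ) :
    perturbed f 0 = f := by
  ext x y
  simp [perturbed]

variable {E F : Type*} [NormedAddCommGroup E] [NormedAddCommGroup F]

lemma isProj_univ (u : E) : IsProj Set.univ u u :=
  ⟨Set.mem_univ u, fun v _ => by simp⟩

lemma surrogate_zero (f : E → F → ℝ) (ry : ℝ) (z : E) : surrogate f 0 ry z = perturbed f ry := by
  ext x y
  simp [surrogate, perturbed]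

lemma potential_eq_surrogate_of_isSaddlePointOn {f : E → F → ℝ} {X : Set E} {Y : Set F}
    {rx ry : ℝ} {u z : E} {w : F} (hb : ∀ x ∈ X, BddAbove (surrogate f rx ry z x '' Y))
    (hu : u ∈ X) (hw : w ∈ Y) (hs : IsSaddlePointOn X Y (surrogate f rx ry z) u w) (x : E) :
    potential f X Y rx ry x w z = surrogate f rx ry z x w := by
  rw [potential, minOver_eq_of_isSaddlePointOn hu hw hs,
    minOver_maxOver_eq_of_isSaddlePointOn hb hu hw hs, sub_add_cancel]

lemma gradX_surrogate [InnerProductSpace ℝ E] [CompleteSpace E] {f : E → F → ℝ} {x : E} {y : F}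
    (hf : DifferentiableAt ℝ (fun u => f u y) x) (rx ry : ℝ) (z : E) :
    gradX (surrogate f rx ry z) x y = gradX f x y + rx • (x - z) := by
  refine HasGradientAt.gradient (hasGradientAt_iff_hasFDerivAt.2 ?_)
  have hderiv := (hf.hasGradientAt.hasFDerivAt.add
    (((hasFDerivAt_id x).sub_const z).norm_sq.const_mul (rx / 2))).sub_const (ry / 2 * ‖y‖ ^ 2)
  refine hderiv.congr_fderiv ?_
  ext v
  simp only [gradX, toDual_gradient, id_eq, map_sub, map_add, map_smul,
    ContinuousLinearMap.comp_id, add_apply, smul_apply, sub_apply, coe_innerSL_apply,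
    nsmul_eq_mul, Nat.cast_ofNat, smul_eq_mul, InnerProductSpace.toDual_apply_apply, add_right_inj]
  ring

lemma gradY_surrogate [InnerProductSpace ℝ F] [CompleteSpace F] {f : E → F → ℝ} {x : E} {y : F}
    (hf : DifferentiableAt ℝ (f x) y) (rx ry : ℝ) (z : E) :
    gradY (surrogate f rx ry z) x y = gradY f x y - ry • y := by
  refine HasGradientAt.gradient (hasGradientAt_iff_hasFDerivAt.2 ?_)
  have hderiv := (hf.hasGradientAt.hasFDerivAt.add_const (rx / 2 * ‖x - z‖ ^ 2)).sub
    ((hasFDerivAt_id y).norm_sq.const_mul (ry / 2))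
  refine hderiv.congr_fderiv ?_
  ext v
  simp only [gradY, toDual_gradient, id_eq, map_sub, map_smul, ContinuousLinearMap.comp_id,
    sub_apply, smul_apply, coe_innerSL_apply, nsmul_eq_mul, Nat.cast_ofNat, smul_eq_mul,
    InnerProductSpace.toDual_apply_apply, sub_right_inj]
  ring

end Surrogate

lemma mem_normalCone_Icc_right {a b v : ℝ} (hv : 0 ≤ v) : v ∈ normalCone (Set.Icc a b) b := by
  intro u hu
  simpa using mul_nonpos_of_nonpos_of_nonneg (sub_nonpos.2 hu.2) hv

lemma isProj_Icc_right {a b u : ℝ} (hab : a ≤ b) (hu : b ≤ u) : IsProj (Set.Icc a b) u b := by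
  refine ⟨Set.right_mem_Icc.2 hab, fun v hv => ?_⟩
  have huv : u - b ≤ u - v := sub_le_sub_left hv.2 u
  simpa [norm_sub_rev _ u, abs_of_nonneg (sub_nonneg.2 hu),
    abs_of_nonneg (sub_nonneg.2 (hv.2.trans hu))] using huv

/-- The hard instance: a quadratic in `x`, coupled with `y` so that the coupling vanishes at
`y = D`. The linear term with slope `a` is there to outweigh the dual perturbation: once
`r_y D ≤ a`, the dual player has no reason to leave `y = D` as long as `0 ≤ x`. -/
noncomputable def coupledQuadratic (l D a x y : ℝ) : ℝ :=
  l / 2 * x ^ 2 + l * x * (y - D) + a * y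

section CoupledQuadratic

variable {l D a rx ry : ℝ}

lemma contDiff_coupledQuadratic :
    ContDiff ℝ 1 (fun q : ℝ × ℝ => coupledQuadratic l D a q.1 q.2) := by
  unfold coupledQuadratic
  fun_prop

lemma differentiable_coupledQuadratic_left (y : ℝ) :
    Differentiable ℝ (fun x => coupledQuadratic l D a x y) := by
  unfold coupledQuadratic
  fun_prop

lemma differentiable_coupledQuadratic_right (x : ℝ) :
    Differentiable ℝ (coupledQuadratic l D a x) := by
  unfold coupledQuadratic
  fun_prop

lemma gradX_coupledQuadratic (x y : ℝ) :
    gradX (coupledQuadratic l D a) x y = l * (x + (y - D)) := by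
  refine (HasDerivAt.hasGradientAt' ?_).gradient
  have hderiv := ((((hasDerivAt_id x).pow 2).const_mul (l / 2)).add
    (((hasDerivAt_id x).const_mul l).mul_const (y - D))).add_const (a * y)
  refine hderiv.congr_deriv ?_
  simp only [id_eq]
  ring

lemma gradY_coupledQuadratic (x y : ℝ) : gradY (coupledQuadratic l D a) x y = l * x + a := by
  refine (HasDerivAt.hasGradientAt' ?_).gradient
  have hderiv := ((((hasDerivAt_id y).sub_const D).const_mul (l * x)).const_add
    (l / 2 * x ^ 2)).add ((hasDerivAt_id y).const_mul a)
  refine hderiv.congr_deriv ?_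
  ring

lemma isLSmooth_coupledQuadratic (hl : 0 ≤ l) (X Y : Set ℝ) :
    IsLSmooth l (coupledQuadratic l D a) X Y where
  contDiff := contDiff_coupledQuadratic
  lipX x _ x' _ y _ y' _ := by
    rw [gradX_coupledQuadratic, gradX_coupledQuadratic, ← mul_sub, norm_mul,
      Real.norm_of_nonneg hl, add_sub_add_comm, sub_sub_sub_cancel_right]
    exact mul_le_mul_of_nonneg_left (norm_add_le _ _) hl
  lipY x _ x' _ y _ y' _ := by
    rw [gradY_coupledQuadratic, gradY_coupledQuadratic, add_sub_add_right_eq_sub, ← mul_sub,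
      norm_mul, Real.norm_of_nonneg hl]
    exact mul_le_mul_of_nonneg_left (le_add_of_nonneg_right (norm_nonneg _)) hl

lemma concaveOn_coupledQuadratic (x : ℝ) {Y : Set ℝ} (hY : Convex ℝ Y) :
    ConcaveOn ℝ Y (coupledQuadratic l D a x) := by
  refine ⟨hY, fun y _ y' _ b b' _ _ hb => le_of_eq ?_⟩
  simp only [coupledQuadratic, smul_eq_mul]
  linear_combination (l / 2 * x ^ 2 - l * x * D) * hb

lemma bddAbove_surrogate_coupledQuadratic (z x : ℝ) :
    BddAbove (surrogate (coupledQuadratic l D a) rx ry z x '' Set.Icc 0 D) :=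
  isCompact_Icc.bddAbove_image (by unfold surrogate coupledQuadratic; fun_prop)

lemma bddAbove_perturbed_coupledQuadratic (x : ℝ) :
    BddAbove (perturbed (coupledQuadratic l D a) ry x '' Set.Icc 0 D) :=
  surrogate_zero (coupledQuadratic l D a) ry (0 : ℝ) ▸ bddAbove_surrogate_coupledQuadratic 0 x

lemma bddAbove_coupledQuadratic (x : ℝ) :
    BddAbove (coupledQuadratic l D a x '' Set.Icc 0 D) :=
  isCompact_Icc.bddAbove_image (differentiable_coupledQuadratic_right x).continuous.continuousOn

lemma isMaxOn_surrogate_coupledQuadratic (hl : 0 ≤ l) (hry : 0 ≤ ry) (ha : ry * D ≤ a) (z : ℝ)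
    {x : ℝ} (hx : 0 ≤ x) :
    IsMaxOn (surrogate (coupledQuadratic l D a) rx ry z x) (Set.Icc 0 D) D := by
  intro y hy
  have hslope : 0 ≤ l * x + (a - ry * D) + ry / 2 * (D - y) :=
    add_nonneg (add_nonneg (mul_nonneg hl hx) (sub_nonneg.2 ha))
      (mul_nonneg (by positivity) (sub_nonneg.2 hy.2))
  have hdiff : surrogate (coupledQuadratic l D a) rx ry z x D -
      surrogate (coupledQuadratic l D a) rx ry z x y =
      (l * x + (a - ry * D) + ry / 2 * (D - y)) * (D - y) := by
    simp only [surrogate, coupledQuadratic, Real.norm_eq_abs, sq_abs]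
    ring
  exact sub_nonneg.1 (hdiff ▸ mul_nonneg hslope (sub_nonneg.2 hy.2))

lemma surrogate_coupledQuadratic_right_eq_add_sq {z u : ℝ} (hu : (l + rx) * u = rx * z) (x : ℝ) :
    surrogate (coupledQuadratic l D a) rx ry z x D =
      surrogate (coupledQuadratic l D a) rx ry z u D + (l + rx) / 2 * (x - u) ^ 2 := by
  simp only [surrogate, coupledQuadratic, Real.norm_eq_abs, sq_abs]
  linear_combination (x - u) * hu

lemma isSaddlePointOn_surrogate_coupledQuadratic (hl : 0 < l) (hrx : 0 ≤ rx) (hry : 0 ≤ ry)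
    (ha : ry * D ≤ a) {z : ℝ} (hz : 0 ≤ z) :
    IsSaddlePointOn Set.univ (Set.Icc 0 D) (surrogate (coupledQuadratic l D a) rx ry z)
      (rx * z / (l + rx)) D := by
  intro x _ y hy
  have hu : (l + rx) * (rx * z / (l + rx)) = rx * z := mul_div_cancel₀ _ (by positivity)
  calc surrogate (coupledQuadratic l D a) rx ry z (rx * z / (l + rx)) y
      ≤ surrogate (coupledQuadratic l D a) rx ry z (rx * z / (l + rx)) D :=
        isMaxOn_surrogate_coupledQuadratic hl.le hry ha z (by positivity) hy
    _ ≤ surrogate (coupledQuadratic l D a) rx ry z x D := by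
        rw [surrogate_coupledQuadratic_right_eq_add_sq hu x]
        exact le_add_of_nonneg_right (by positivity)

lemma isSaddlePointOn_perturbed_coupledQuadratic (hl : 0 < l) (hry : 0 ≤ ry)
    (ha : ry * D ≤ a) :
    IsSaddlePointOn Set.univ (Set.Icc 0 D) (perturbed (coupledQuadratic l D a) ry) 0 D := by
  simpa [surrogate_zero] using
    isSaddlePointOn_surrogate_coupledQuadratic hl le_rfl hry ha le_rfl

lemma isInstance_coupledQuadratic (hl : 0 < l) (hD : 0 ≤ D) (hry : 0 ≤ ry) (ha : ry * D ≤ a) :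
    IsInstance l D ry (coupledQuadratic l D a) where
  smooth := isLSmooth_coupledQuadratic hl.le _ _
  concave x := concaveOn_coupledQuadratic x (convex_Icc 0 D)
  attained := ⟨0, isMinOn_maxOver_of_isSaddlePointOn
    (fun x _ => bddAbove_perturbed_coupledQuadratic x) (Set.mem_univ 0) (Set.right_mem_Icc.2 hD)
    (isSaddlePointOn_perturbed_coupledQuadratic hl hry ha)⟩

lemma initialGap_coupledQuadratic (hl : 0 < l) (hD : 0 ≤ D) (hrx : 0 ≤ rx) (hry : 0 ≤ ry)
    (ha : ry * D ≤ a) {z : ℝ} (hz : 0 ≤ z) (x : ℝ) :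
    initialGap (coupledQuadratic l D a) Set.univ (Set.Icc 0 D) rx ry x D z =
      l / 2 * x ^ 2 + rx / 2 * (x - z) ^ 2 := by
  have hDmem : D ∈ Set.Icc 0 D := Set.right_mem_Icc.2 hD
  rw [initialGap,
    potential_eq_surrogate_of_isSaddlePointOn (fun x _ => bddAbove_surrogate_coupledQuadratic z x)
      (Set.mem_univ _) hDmem (isSaddlePointOn_surrogate_coupledQuadratic hl hrx hry ha hz) x,
    minOver_maxOver_eq_of_isSaddlePointOn (fun x _ => bddAbove_perturbed_coupledQuadratic x)
      (Set.mem_univ _) hDmem (isSaddlePointOn_perturbed_coupledQuadratic hl hry ha)]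
  simp only [surrogate, perturbed, coupledQuadratic, Real.norm_eq_abs, sq_abs]
  ring

lemma infDist_dual_coupledQuadratic {x : ℝ} (hg : 0 ≤ l * x + a) :
    Metric.infDist 0 ((fun v => -gradY (coupledQuadratic l D a) x D + v) ''
      normalCone (Set.Icc 0 D) D) = 0 := by
  rw [gradY_coupledQuadratic]
  exact Metric.infDist_zero_of_mem ⟨l * x + a, mem_normalCone_Icc_right hg, neg_add_cancel _⟩

lemma isGS_coupledQuadratic_iff (hl : 0 ≤ l) (hD : 0 ≤ D) (ha : 0 ≤ a) {ε x : ℝ} (hε : 0 ≤ ε)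
    (hx : 0 ≤ x) :
    IsGS ε (coupledQuadratic l D a) Set.univ (Set.Icc 0 D) x D ↔ l * x ≤ ε := by
  have hlx : 0 ≤ l * x := mul_nonneg hl hx
  rw [IsGS, infDist_zero_add_normalCone_univ, infDist_dual_coupledQuadratic (add_nonneg hlx ha),
    gradX_coupledQuadratic, sub_self, add_zero, Real.norm_of_nonneg hlx]
  simp [hD, hε]

lemma maxOver_coupledQuadratic (hl : 0 ≤ l) (hD : 0 ≤ D) (ha : 0 ≤ a) {x : ℝ} (hx : 0 ≤ x) :
    maxOver (Set.Icc 0 D) (coupledQuadratic l D a) x = coupledQuadratic l D a x D := by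
  refine maxOver_eq_of_isMaxOn (Set.right_mem_Icc.2 hD) ?_
  simpa [surrogate_zero, perturbed_zero] using
    isMaxOn_surrogate_coupledQuadratic (rx := 0) hl le_rfl ((zero_mul D).trans_le ha) 0 hx

lemma isProx_coupledQuadratic_iff (hl : 0 < l) (hD : 0 ≤ D) (ha : 0 ≤ a) {r x p : ℝ} (hr : 0 < r)
    (hx : 0 ≤ x) :
    IsProx r (maxOver (Set.Icc 0 D) (coupledQuadratic l D a)) Set.univ x p ↔
      p = x / (1 + r * l) := by
  have hu_eq : (l + 1 / r) * (x / (1 + r * l)) = 1 / r * x := by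
    field_simp
    ring
  have hu_nonneg : 0 ≤ x / (1 + r * l) := by positivity
  generalize x / (1 + r * l) = u at hu_eq hu_nonneg ⊢
  rw [IsProx, and_iff_right (Set.mem_univ p)]
  refine isMinOn_iff_eq_of_forall_lt (Set.mem_univ u) (Set.mem_univ p) fun v _ hvu => ?_
  have hgrowth := surrogate_coupledQuadratic_right_eq_add_sq (D := D) (a := a) (ry := 0) hu_eq v
  simp only [surrogate, zero_div, zero_mul, sub_zero, div_div, mul_comm r] at hgrowth
  have hgap : 0 < (l + 1 / r) / 2 * (v - u) ^ 2 :=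
    mul_pos (by positivity) (sq_pos_of_ne_zero (sub_ne_zero.2 hvu))
  have hv := le_maxOver (bddAbove_coupledQuadratic (l := l) (a := a) v) (Set.right_mem_Icc.2 hD)
  rw [maxOver_coupledQuadratic hl.le hD ha hu_nonneg]
  linarith

lemma isOS_coupledQuadratic_iff (hl : 0 < l) (hD : 0 ≤ D) (ha : 0 ≤ a) {ε x : ℝ}
    (hx : 0 ≤ x) :
    IsOS l ε (coupledQuadratic l D a) Set.univ (Set.Icc 0 D) x ↔ l * x ≤ 3 / 2 * ε := by
  simp only [IsOS, isProx_coupledQuadratic_iff hl hD ha (by positivity : 0 < 1 / (2 * l)) hx,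
    exists_eq_left, Set.mem_univ, true_and]
  have hprox : x / (1 + 1 / (2 * l) * l) - x = -(x / 3) := by
    field_simp
    ring
  rw [hprox, norm_neg, Real.norm_of_nonneg (by positivity), le_div_iff₀ (by positivity)]
  constructor <;> intro h <;> linarith

end CoupledQuadratic

/-- Two coupled moving averages started at `R`: `x` moves the fraction `θ` of the way towards
`ρ z`, and then `z` moves the fraction `β` of the way towards `x`. Smoothed gradient descent on
`(l / 2) x²` has this form with `θ = c (l + r_x)` and `ρ = r_x / (l + r_x)`, so that `ρ z` is the
proximal point of the centre `z`. -/
structure IsCoupledAverage (θ ρ β R : ℝ) (x z : ℕ → ℝ) : Prop where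
  x_zero : x 0 = R
  z_zero : z 0 = R
  x_succ : ∀ t, x (t + 1) = (1 - θ) * x t + θ * (ρ * z t)
  z_succ : ∀ t, z (t + 1) = (1 - β) * z t + β * x (t + 1)

lemma exists_isCoupledAverage (θ ρ β R : ℝ) : ∃ x z, IsCoupledAverage θ ρ β R x z := by
  let q : ℕ → ℝ × ℝ := Nat.rec (R, R) fun _ q =>
    let x' := (1 - θ) * q.1 + θ * (ρ * q.2)
    (x', (1 - β) * q.2 + β * x')
  exact ⟨fun t => (q t).1, fun t => (q t).2, rfl, rfl, fun _ => rfl, fun _ => rfl⟩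

namespace IsCoupledAverage

variable {θ ρ β R : ℝ} {x z : ℕ → ℝ}

lemma x_succ_mem_Icc (h : IsCoupledAverage θ ρ β R x z) (hθ : θ ∈ Set.Icc 0 1) {t : ℕ}
    (hx : x t ∈ Set.Icc (ρ * z t) (z t)) :
    x (t + 1) ∈ Set.Icc (ρ * z t) ((1 - θ * (1 - ρ)) * z t) := by
  rw [h.x_succ]
  constructor
  · linarith [mul_le_mul_of_nonneg_left hx.1 (sub_nonneg.2 hθ.2)]
  · linarith [mul_le_mul_of_nonneg_left hx.2 (sub_nonneg.2 hθ.2)]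

lemma mem_cone (h : IsCoupledAverage θ ρ β R x z) (hθ : θ ∈ Set.Icc 0 1) (hρ : ρ ∈ Set.Icc 0 1)
    (hβ : β ∈ Set.Icc 0 1) (hR : 0 ≤ R) (t : ℕ) :
    0 ≤ z t ∧ x t ∈ Set.Icc (ρ * z t) (z t) := by
  induction t with
  | zero =>
    rw [h.x_zero, h.z_zero]
    exact ⟨hR, mul_le_of_le_one_left hR hρ.2, le_rfl⟩
  | succ t ih =>
    obtain ⟨hz, hx⟩ := ih
    obtain ⟨hlow, hupp⟩ := h.x_succ_mem_Icc hθ hx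
    have hx_nonneg : 0 ≤ x (t + 1) := (mul_nonneg hρ.1 hz).trans hlow
    have hx_le : x (t + 1) ≤ z t := hupp.trans <| mul_le_of_le_one_left hz <|
      sub_le_self 1 (mul_nonneg hθ.1 (sub_nonneg.2 hρ.2))
    have hz_anti : z (t + 1) ≤ z t := by
      linarith [h.z_succ t, mul_le_mul_of_nonneg_left hx_le hβ.1]
    refine ⟨?_, (mul_le_mul_of_nonneg_left hz_anti hρ.1).trans hlow, ?_⟩
    · rw [h.z_succ]
      exact add_nonneg (mul_nonneg (sub_nonneg.2 hβ.2) hz) (mul_nonneg hβ.1 hx_nonneg)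
    · linarith [h.z_succ t, mul_le_mul_of_nonneg_left hx_le (sub_nonneg.2 hβ.2)]

lemma x_nonneg (h : IsCoupledAverage θ ρ β R x z) (hθ : θ ∈ Set.Icc 0 1) (hρ : ρ ∈ Set.Icc 0 1)
    (hβ : β ∈ Set.Icc 0 1) (hR : 0 ≤ R) (t : ℕ) : 0 ≤ x t :=
  have hcone := h.mem_cone hθ hρ hβ hR t
  (mul_nonneg hρ.1 hcone.1).trans hcone.2.1

lemma one_sub_pow_mul_le_z (h : IsCoupledAverage θ ρ β R x z) (hβ : β ∈ Set.Icc 0 1)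
    (hx : ∀ t, 0 ≤ x t) (t : ℕ) : (1 - β) ^ t * R ≤ z t := by
  induction t with
  | zero => simp [h.z_zero]
  | succ t ih =>
    rw [pow_succ', mul_assoc, h.z_succ]
    exact (mul_le_mul_of_nonneg_left ih (sub_nonneg.2 hβ.2)).trans
      (le_add_of_nonneg_right (mul_nonneg hβ.1 (hx _)))

lemma mul_one_sub_mul_le_x (h : IsCoupledAverage θ ρ β R x z) (hθ : θ ∈ Set.Icc 0 1)
    (hρ : ρ ∈ Set.Icc 0 1) (hβ : β ∈ Set.Icc 0 1) (hR : 0 ≤ R) (t : ℕ) :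
    ρ * ((1 - β * t) * R) ≤ x t := by
  have hbernoulli : 1 - β * t ≤ (1 - β) ^ t := by
    simpa [sub_eq_add_neg, mul_comm] using one_add_mul_le_pow (by linarith [hβ.2] : -2 ≤ -β) t
  calc ρ * ((1 - β * t) * R) ≤ ρ * ((1 - β) ^ t * R) :=
        mul_le_mul_of_nonneg_left (mul_le_mul_of_nonneg_right hbernoulli hR) hρ.1
    _ ≤ ρ * z t :=
        mul_le_mul_of_nonneg_left (h.one_sub_pow_mul_le_z hβ (h.x_nonneg hθ hρ hβ hR) t) hρ.1
    _ ≤ x t := (h.mem_cone hθ hρ hβ hR t).2.1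

lemma half_le_mul_of_x_le (h : IsCoupledAverage θ ρ β R x z) (hθ : θ ∈ Set.Icc 0 1)
    (hρ : ρ ∈ Set.Ioc 0 1) (hβ : β ∈ Set.Icc 0 1) (hR : 0 < R) {t : ℕ} (hx : x t ≤ ρ * R / 2) :
    1 / 2 ≤ β * t := by
  have hlow := h.mul_one_sub_mul_le_x hθ (Set.Ioc_subset_Icc_self hρ) hβ hR.le t
  have hscaled : ρ * R * (1 - β * t) ≤ ρ * R * (1 / 2) := by linarith
  linarith [le_of_mul_le_mul_left hscaled (mul_pos hρ.1 hR)]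

lemma z_le_pow_mul (h : IsCoupledAverage θ ρ β R x z) (hθ : θ ∈ Set.Icc 0 1)
    (hρ : ρ ∈ Set.Icc 0 1) (hβ : β ∈ Set.Icc 0 1) (hR : 0 ≤ R) (t : ℕ) :
    z t ≤ (1 - β * (θ * (1 - ρ))) ^ t * R := by
  have hrate : β * (θ * (1 - ρ)) ∈ Set.Icc 0 1 :=
    unitInterval.mul_mem hβ (unitInterval.mul_mem hθ (Set.Icc.one_sub_mem hρ))
  induction t with
  | zero => simp [h.z_zero]
  | succ t ih =>
    have hx := (h.x_succ_mem_Icc hθ (h.mem_cone hθ hρ hβ hR t).2).2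
    calc z (t + 1) = (1 - β) * z t + β * x (t + 1) := h.z_succ t
      _ ≤ (1 - β) * z t + β * ((1 - θ * (1 - ρ)) * z t) :=
          add_le_add_right (mul_le_mul_of_nonneg_left hx hβ.1) _
      _ = (1 - β * (θ * (1 - ρ))) * z t := by ring
      _ ≤ (1 - β * (θ * (1 - ρ))) * ((1 - β * (θ * (1 - ρ))) ^ t * R) :=
          mul_le_mul_of_nonneg_left ih (sub_nonneg.2 hrate.2)
      _ = (1 - β * (θ * (1 - ρ))) ^ (t + 1) * R := by ring

lemma exists_x_lt (h : IsCoupledAverage θ ρ β R x z) (hθ : θ ∈ Set.Ioc 0 1)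
    (hρ : ρ ∈ Set.Ico 0 1) (hβ : β ∈ Set.Ioc 0 1) (hR : 0 ≤ R) {δ : ℝ} (hδ : 0 < δ) :
    ∃ t, x t < δ := by
  have hθ' := Set.Ioc_subset_Icc_self hθ
  have hρ' := Set.Ico_subset_Icc_self hρ
  have hβ' := Set.Ioc_subset_Icc_self hβ
  have hrate_pos : 0 < β * (θ * (1 - ρ)) := mul_pos hβ.1 (mul_pos hθ.1 (sub_pos.2 hρ.2))
  have hrate_mem : β * (θ * (1 - ρ)) ∈ Set.Icc 0 1 :=
    unitInterval.mul_mem hβ' (unitInterval.mul_mem hθ' (Set.Icc.one_sub_mem hρ'))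
  have hlim := (tendsto_pow_atTop_nhds_zero_of_lt_one (sub_nonneg.2 hrate_mem.2)
    (sub_lt_self 1 hrate_pos)).mul_const R
  rw [zero_mul] at hlim
  obtain ⟨t, ht⟩ := (hlim.eventually_lt_const hδ).exists
  exact ⟨t, ((h.mem_cone hθ' hρ' hβ' hR t).2.2.trans (h.z_le_pow_mul hθ' hρ' hβ' hR t)).trans_lt ht⟩

lemma isPSGDARun_coupledQuadratic {l D a : ℝ} {p : PSGDAParams}
    (h : IsCoupledAverage (p.c * (l + p.rx)) (p.rx / (l + p.rx)) p.β R x z)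
    (hl : 0 ≤ l) (hlr : 0 < l + p.rx) (hD : 0 ≤ D) (hα : 0 ≤ p.α) (ha : p.ry * D ≤ a)
    (hx : ∀ t, 0 ≤ x t) :
    IsPSGDARun (coupledQuadratic l D a) Set.univ (Set.Icc 0 D) p x (fun _ => D) z where
  init_x := Set.mem_univ _
  init_y := Set.right_mem_Icc.2 hD
  step_x t := by
    have hstep : x (t + 1) = x t - p.c * (l * x t + p.rx * (x t - z t)) := by
      rw [h.x_succ]
      field_simp
      ring
    rw [gradX_surrogate (differentiable_coupledQuadratic_left D _), gradX_coupledQuadratic,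
      sub_self, add_zero, smul_eq_mul, smul_eq_mul, ← hstep]
    exact isProj_univ _
  step_y t := by
    rw [gradY_surrogate (differentiable_coupledQuadratic_right _ D), gradY_coupledQuadratic,
      smul_eq_mul, smul_eq_mul, add_sub_assoc]
    refine isProj_Icc_right hD (le_add_of_nonneg_right (mul_nonneg hα ?_))
    exact add_nonneg (mul_nonneg hl (hx _)) (sub_nonneg.2 ha)
  step_z t := by
    rw [h.z_succ, smul_eq_mul]
    ring

end IsCoupledAverage

lemma exists_instance_half_le_mul {l D ε R : ℝ} {p : PSGDAParams} (hl : 0 < l) (hD : 0 < D)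
    (hε : 0 < ε) (hrx : 0 < p.rx) (hry : 0 < p.ry) (hc : 0 < p.c) (hc_le : p.c ≤ 1 / (p.rx + l))
    (hα : 0 ≤ p.α) (hβ : p.β ∈ Set.Ioc 0 1) (hR : 3 * ε ≤ p.rx / (l + p.rx) * (l * R)) :
    ∃ (f : ℝ → ℝ → ℝ) (x y z : ℕ → ℝ),
      IsInstance l D p.ry f ∧
      IsPSGDARun f Set.univ (Set.Icc 0 D) p x y z ∧
      initialGap f Set.univ (Set.Icc 0 D) p.rx p.ry (x 0) (y 0) (z 0) = l / 2 * R ^ 2 ∧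
      (∃ T, IsGS ε f Set.univ (Set.Icc 0 D) (x T) (y T)) ∧
      (∃ T, IsOS l ε f Set.univ (Set.Icc 0 D) (x T)) ∧
      (∀ T, IsGS ε f Set.univ (Set.Icc 0 D) (x T) (y T) → 1 / 2 ≤ p.β * T) ∧
      ∀ T, IsOS l ε f Set.univ (Set.Icc 0 D) (x T) → 1 / 2 ≤ p.β * T := by
  have hlr : 0 < l + p.rx := add_pos hl hrx
  have hθ : p.c * (l + p.rx) ∈ Set.Ioc 0 1 :=
    ⟨mul_pos hc hlr, (le_div_iff₀ hlr).1 (add_comm l p.rx ▸ hc_le)⟩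
  have hρ : p.rx / (l + p.rx) ∈ Set.Ioo 0 1 :=
    ⟨div_pos hrx hlr, (div_lt_one hlr).2 (lt_add_of_pos_left _ hl)⟩
  have hR_pos : 0 < R :=
    pos_of_mul_pos_right
      (pos_of_mul_pos_right ((by positivity : 0 < 3 * ε).trans_le hR) hρ.1.le) hl.le
  have hθ' := Set.Ioc_subset_Icc_self hθ
  have hβ' := Set.Ioc_subset_Icc_self hβ
  have ha : 0 ≤ p.ry * D := by positivity
  obtain ⟨x, z, h⟩ := exists_isCoupledAverage (p.c * (l + p.rx)) (p.rx / (l + p.rx)) p.β R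
  have hx := h.x_nonneg hθ' (Set.Ioo_subset_Icc_self hρ) hβ' hR_pos.le
  have hgs T := isGS_coupledQuadratic_iff hl.le hD.le ha hε.le (hx T)
  have hos T := isOS_coupledQuadratic_iff (ε := ε) hl hD.le ha (hx T)
  have hslow : ∀ T, l * x T ≤ 3 / 2 * ε → 1 / 2 ≤ p.β * T := fun T hT =>
    h.half_le_mul_of_x_le hθ' (Set.Ioo_subset_Ioc_self hρ) hβ' hR_pos
      (le_of_mul_le_mul_left (by linarith) hl)
  obtain ⟨T₀, hT₀⟩ := h.exists_x_lt hθ (Set.Ioo_subset_Ico_self hρ) hβ hR_pos.le (div_pos hε hl)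
  rw [lt_div_iff₀' hl] at hT₀
  refine ⟨coupledQuadratic l D (p.ry * D), x, fun _ => D, z,
    isInstance_coupledQuadratic hl hD.le hry.le le_rfl,
    h.isPSGDARun_coupledQuadratic hl.le hlr hD.le hα le_rfl hx, ?_, ⟨T₀, (hgs T₀).2 hT₀.le⟩,
    ⟨T₀, (hos T₀).2 (by linarith)⟩, fun T hT => hslow T (((hgs T).1 hT).trans (by linarith)),
    fun T hT => hslow T ((hos T).1 hT)⟩
  rw [h.x_zero, h.z_zero,
    initialGap_coupledQuadratic hl hD.le hrx.le hry.le le_rfl hR_pos.le]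
  ring

lemma div_le_of_half_le_mul {K l B β ry T : ℝ} (hK : 0 < K) (hl : 0 < l) (hB : 0 < B)
    (hT : 0 ≤ T) (hβ : β ≤ K * (ry / l)) (hry : ry ≤ K * B) (h : 1 / 2 ≤ β * T) :
    l / (2 * K ^ 2 * B) ≤ T := by
  have hβ_le : β ≤ K * (K * B / l) := hβ.trans (by gcongr)
  have hhalf : 1 / 2 ≤ K ^ 2 * B / l * T := calc
    1 / 2 ≤ β * T := h
    _ ≤ K * (K * B / l) * T := mul_le_mul_of_nonneg_right hβ_le hT
    _ = K ^ 2 * B / l * T := by ring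
  calc l / (2 * K ^ 2 * B) = 1 / 2 / (K ^ 2 * B / l) := by field_simp
    _ ≤ T := (div_le_iff₀' (by positivity)).2 hhalf

theorem mainTheorem2_general {K : ℝ} (hK : 1 ≤ K) :
    ∃ κ : ℝ, 0 < κ ∧ ∀ (l D ε : ℝ), 0 < l → 0 < D → 0 < ε → ∀ p : PSGDAParams,
      l / K ≤ p.rx → 0 < p.c → p.c ≤ 1 / (p.rx + l) → 0 ≤ p.α →
      p.β ∈ Set.Ioc 0 1 → p.β ≤ K * (p.ry / l) →
        ∃ (f : ℝ → ℝ → ℝ) (x y z : ℕ → ℝ),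
          IsInstance l D p.ry f ∧
          IsPSGDARun f Set.univ (Set.Icc 0 D) p x y z ∧
          κ * (ε ^ 2 / l) ≤
            initialGap f Set.univ (Set.Icc 0 D) p.rx p.ry (x 0) (y 0) (z 0) ∧
          (∃ T : ℕ, IsGS ε f Set.univ (Set.Icc 0 D) (x T) (y T)) ∧
          (∃ T : ℕ, IsOS l ε f Set.univ (Set.Icc 0 D) (x T)) ∧
          (p.ry ≤ K * (ε / D) →
            ∀ T : ℕ, IsGS ε f Set.univ (Set.Icc 0 D) (x T) (y T) →
              κ * (l ^ 2 * D *
                initialGap f Set.univ (Set.Icc 0 D) p.rx p.ry (x 0) (y 0) (z 0) / ε ^ 3) ≤ T) ∧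
          (p.ry ≤ K * (ε ^ 2 / (l * D ^ 2)) →
            ∀ T : ℕ, IsOS l ε f Set.univ (Set.Icc 0 D) (x T) →
              κ * (l ^ 3 * D ^ 2 *
                initialGap f Set.univ (Set.Icc 0 D) p.rx p.ry (x 0) (y 0) (z 0) / ε ^ 4) ≤ T) := by
  have hK_pos : 0 < K := by linarith
  refine ⟨1 / (9 * K ^ 2 * (K + 1) ^ 2), by positivity,
    fun l D ε hl hD hε p hrx hc hc_le hα hβ hβ_le => ?_⟩
  have hrx_pos : 0 < p.rx := (div_pos hl hK_pos).trans_le hrx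
  have hry : 0 < p.ry :=
    (div_pos_iff_of_pos_right hl).1 (pos_of_mul_pos_right (hβ.1.trans_le hβ_le) hK_pos.le)
  have hR : 3 * ε ≤ p.rx / (l + p.rx) * (l * (3 * (K + 1) * (ε / l))) := by
    rw [div_mul_eq_mul_div, le_div_iff₀ (by positivity), mul_left_comm l, mul_div_cancel₀ _ hl.ne']
    linarith [mul_le_mul_of_nonneg_left ((div_le_iff₀ hK_pos).1 hrx) hε.le]
  obtain ⟨f, x, y, z, hinst, hrun, hgap, hgs, hos, hgs_slow, hos_slow⟩ :=
    exists_instance_half_le_mul hl hD hε hrx_pos hry hc hc_le hα hβ hR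
  refine ⟨f, x, y, z, hinst, hrun, ?_, hgs, hos, fun hry_le T hT => ?_, fun hry_le T hT => ?_⟩
  · have hκ_le : 1 / (9 * K ^ 2 * (K + 1) ^ 2) ≤ 9 / 2 * (K + 1) ^ 2 := by
      rw [div_le_iff₀ (by positivity)]
      nlinarith [one_le_pow₀ hK (n := 2), one_le_pow₀ (by linarith : 1 ≤ K + 1) (n := 4)]
    calc 1 / (9 * K ^ 2 * (K + 1) ^ 2) * (ε ^ 2 / l)
        ≤ 9 / 2 * (K + 1) ^ 2 * (ε ^ 2 / l) := by gcongr
      _ = l / 2 * (3 * (K + 1) * (ε / l)) ^ 2 := by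
        field_simp
        norm_num
      _ = _ := hgap.symm
  · have hT_le := div_le_of_half_le_mul hK_pos hl (by positivity) T.cast_nonneg hβ_le hry_le
      (hgs_slow T hT)
    refine le_of_eq_of_le ?_ hT_le
    rw [hgap]
    field_simp
    norm_num
  · have hT_le := div_le_of_half_le_mul hK_pos hl (by positivity) T.cast_nonneg hβ_le hry_le
      (hos_slow T hT)
    refine le_of_eq_of_le ?_ hT_le
    rw [hgap]
    field_simp
    norm_num

theorem mainTheorem2 :
    ∀ K : ℝ, 1 ≤ K → ∃ κ : ℝ, 0 < κ ∧
      ∀ (l D ε : ℝ), 0 < l → 0 < D → 0 < ε → ∀ p : PSGDAParams, p.StepSizeCondition K l →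
        (IsTheta K p.ry (ε / D) →
          ∃ (f : ℝ → ℝ → ℝ) (x y z : ℕ → ℝ),
            IsInstance l D p.ry f ∧
            IsPSGDARun f Set.univ (Set.Icc 0 D) p x y z ∧
            κ * (ε ^ 2 / l) ≤
              initialGap f Set.univ (Set.Icc 0 D) p.rx p.ry (x 0) (y 0) (z 0) ∧
            (∃ T : ℕ, IsGS ε f Set.univ (Set.Icc 0 D) (x T) (y T)) ∧
            ∀ T : ℕ, IsGS ε f Set.univ (Set.Icc 0 D) (x T) (y T) →
              κ * (l ^ 2 * D *
                initialGap f Set.univ (Set.Icc 0 D) p.rx p.ry (x 0) (y 0) (z 0) / ε ^ 3)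
                ≤ (T : ℝ)) ∧
        (IsTheta K p.ry (ε ^ 2 / (l * D ^ 2)) →
          ∃ (f : ℝ → ℝ → ℝ) (x y z : ℕ → ℝ),
            IsInstance l D p.ry f ∧
            IsPSGDARun f Set.univ (Set.Icc 0 D) p x y z ∧
            κ * (ε ^ 2 / l) ≤
              initialGap f Set.univ (Set.Icc 0 D) p.rx p.ry (x 0) (y 0) (z 0) ∧
            (∃ T : ℕ, IsOS l ε f Set.univ (Set.Icc 0 D) (x T)) ∧
            ∀ T : ℕ, IsOS l ε f Set.univ (Set.Icc 0 D) (x T) →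
              κ * (l ^ 3 * D ^ 2 *
                initialGap f Set.univ (Set.Icc 0 D) p.rx p.ry (x 0) (y 0) (z 0) / ε ^ 4)
                ≤ (T : ℝ)) := by
  intro K hK
  obtain ⟨κ, hκ, hgeneral⟩ := mainTheorem2_general hK
  refine ⟨κ, hκ, fun l D ε hl hD hε p hp => ?_⟩
  obtain ⟨f, x, y, z, hinst, hrun, hgap, hgs, hos, hgs_slow, hos_slow⟩ :=
    hgeneral l D ε hl hD hε p hp.rx_theta.1 hp.c_pos hp.c_lt.le hp.α_pos.le
      ⟨hp.β_pos, (le_min_iff.1 hp.β_le).1.trans (by norm_num)⟩ hp.β_theta.2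
  exact ⟨fun hθ => ⟨f, x, y, z, hinst, hrun, hgap, hgs, hgs_slow hθ.2⟩,
    fun hθ => ⟨f, x, y, z, hinst, hrun, hgap, hos, hos_slow hθ.2⟩⟩
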